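/- Let $\Sigma=\{0,1\}$ and let $\Sigma^*$ be the set of finite binary strings. For $f:\Sigma^*\to\Sigma$ and $T\ge 1$, let $f^{\mathrm{CoT}\text{-}T}(x)$ be the string obtained from $x\in\Sigma^*$ by applying $T$ times the map $\bar f(x)=\mathrm{append}(x,f(x))$, and let $f^{\mathrm{e2e}\text{-}T}(x)$ be its last symbol. For $d\ge 1$ let $\mathcal F_{d,\mathrm{lin}}$ be the class of all functions $$f_{w,b}(x)=\mathbf 1\Big[\sum_{i=1}^{\min(d,|x|)} w[-i]\,x[-i]+b\ge 0\Big],\qquad w\in\mathbb R^d,\ b\in\mathbb R,$$ on $\Sigma^*$, where $v[-i]$ denotes the $i$-th entry of $v$ from the end. The class $\mathrm{e2e}^T(\mathcal F_{d,\mathrm{lin}})=\{f^{\mathrm{e2e}\text{-}T}:f\in\mathcal F_{d,\mathrm{lin}}\}$ is *e2e-learned* (respectively *CoT-learned*) by a rule $A$ with sample complexity $m(\varepsilon,\delta)\in\mathbb N$ if for every probability distribution $\mathcal D$ on $\Sigma^*$, every $f_*\in\mathcal F_{d,\mathrm{lin}}$ and all $0<\varepsilon,\delta<1$, with probability at least $1-\delta$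 over i.i.d. $x_1,\dots,x_m\sim\mathcal D$, $m=m(\varepsilon,\delta)$, the predictor $h=A(S):\Sigma^*\to\Sigma$ satisfies $\mathbb P_{x\sim\mathcal D}\big(h(x)\ne f_*^{\mathrm{e2e}\text{-}T}(x)\big)\le\varepsilon$; here $S=\big((x_i,f_*^{\mathrm{e2e}\text{-}T}(x_i))\big)_{i\le m}$ (respectively $S=\big(f_*^{\mathrm{CoT}\text{-}T}(x_i)\big)_{i\le m}$). It is e2e-learnable (CoT-learnable) with sample complexity $m$ if some rule does so. The rule $\mathrm{Cons}_{\mathrm{e2e}}$ returns, on a sample $S=((x_i,y_i))_i$, a function $\hat f^{\mathrm{e2e}\text{-}T}$ for some $\hat f\in\mathcal F_{d,\mathrm{lin}}$ with $\hat f^{\mathrm{e2e}\text{-}T}(x_i)=y_i$ for all $i$, whenever such an $\hat f$ exists; the rule $\mathrm{Cons}_{\mathrm{CoT}}$ returns, on a sample $S=(z_i)_i$, a function $\hat f^{\mathrm{e2e}\text{-}T}$ for some $\hat f\in\mathcal F_{d,\mathrm{lin}}$ with $\hat f^{\mathrm{CoT}\text{-}T}(x_i)=z_i$ for all $i$, where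 $x_i$ is $z_i$ without its last $T$ symbols, whenever such an $\hat f$ exists. In both cases the choice of $\hat f$, and the output when there is none, are arbitrary. **Theorem.** 1. For every $d\ge 1$, the number of distinct functions obtained by restricting the members of $\mathcal F_{d,\mathrm{lin}}$ to $\{0,1\}^d$ is at most $(2e\cdot 2^d)^{d+1}$, and this number is $2^{O(d^2)}$. 2. For all $d,T\ge 1$, $\mathrm{e2e}^T(\mathcal F_{d,\mathrm{lin}})$ is e2e-learnable, namely by every implementation of $\mathrm{Cons}_{\mathrm{e2e}}$, with a sample complexity $$m^{\mathrm{e2e}}(\varepsilon,\delta)=O\!\left(\frac{\min\{d^2,\ d\,T\log(2/\varepsilon)\}+\log(1/\delta)}{\varepsilon}\right).$$ 3. For all $d,T\ge 1$, $\mathrm{e2e}^T(\mathcal F_{d,\mathrm{lin}})$ is CoT-learnable, namely by every implementation of $\mathrm{Cons}_{\mathrm{CoT}}$, with a sample complexity $$m^{\mathrm{CoT}}(\varepsilon,\delta)=O\!\left(\frac{\min\{d^2,\ d\,\log(2T)\log(2/\varepsilon)\}+\log(1/\delta)}{\varepsilon}\right).$$ The constants in $O(\cdot)$ are absolute: they do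 not depend on $d$, $T$, $\varepsilon$, $\delta$, the distribution, the target or the implementation of the rule. -/

import Mathlib

open MeasureTheory

/-- Strings over the binary alphabet `{0, 1}`; the last token of the string is the last entry of
the list. -/
abbrev Str : Type := List Bool

/-- The set of all strings is countable, and every subset of it is an event. -/
instance instMeasurableSpaceStr : MeasurableSpace (List Bool) := ⊤

/-- A next-token generator. -/
abbrev Generator : Type := Str → Bool

/-- Apply-and-append: `x ↦ append(x, f x)`. -/
def applyAppend (f : Generator) (x : Str) : Str := x ++ [f x]

/-- The `T`-step Chain-of-Thought of `f` on `x`, a string of length `|x| + T`. -/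
def cot (f : Generator) (T : ℕ) (x : Str) : Str := (applyAppend f)^[T] x

/-- The end-to-end map: the last token of the Chain-of-Thought (the default value `false` plays
no role when `T ≥ 1`, since the Chain-of-Thought is then a nonempty string). -/
def ete (f : Generator) (T : ℕ) (x : Str) : Bool := (cot f T x).getLastD false

/-- The real number `0` or `1` that a token stands for. -/
def bit (c : Bool) : ℝ := if c then 1 else 0

open Classical in
/-- The linear threshold generator
`f_{w,b}(x) = 1[∑_{i=1}^{min(d,|x|)} w[-i] x[-i] + b ≥ 0]`.
For `i : Fin d`, `w i.rev` is `w[-(i+1)]` and `x.reverse.getD i false` is `x[-(i+1)]` if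
`i < |x|`; the terms with `i ≥ |x|` vanish. -/
noncomputable def linThreshold {d : ℕ} (w : Fin d → ℝ) (b : ℝ) : Generator := fun x =>
  decide (0 ≤ (∑ i : Fin d, w i.rev * bit (x.reverse.getD i false)) + b)

/-- The base class of `d`-dimensional linear thresholds. -/
def linClass (d : ℕ) : Set Generator :=
  {f | ∃ (w : Fin d → ℝ) (b : ℝ), f = linThreshold w b}

/-- The restriction of a class of generators to the domain `{0,1}^n`. -/
def restrictToLength (F : Set Generator) (n : ℕ) : Set (List.Vector Bool n → Bool) :=
  (fun (f : Generator) (x : List.Vector Bool n) => f x.toList) '' F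

/-- The population 0-1 error of the predictor `h` when the target is `ete f T`. -/
noncomputable def popError (D : Measure Str) (f : Generator) (T : ℕ) (h : Str → Bool) : ℝ :=
  D.real {x | h x ≠ ete f T x}

/-- A learning rule that sees inputs with final answers only. -/
abbrev E2ERule : Type := List (Str × Bool) → Str → Bool

/-- A learning rule that sees the strings `z = cot f T x`, that is, inputs followed by their
entire Chain-of-Thought. -/
abbrev CoTRule : Type := List Str → Str → Bool

/-- The training set of inputs `x i` with the final answers `ete f T (x i)`. -/
def e2eSample (f : Generator) (T : ℕ) {m : ℕ} (x : Fin m → Str) : List (Str × Bool) :=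
  List.ofFn fun i => (x i, ete f T (x i))

/-- The training set of the strings `cot f T (x i)`. -/
def cotSample (f : Generator) (T : ℕ) {m : ℕ} (x : Fin m → Str) : List Str :=
  List.ofFn fun i => cot f T (x i)

/-- The rule `A` learns `ete F T` from final answers with sample complexity `m`, in the realizable
setting. -/
def E2ELearnsWith (F : Set Generator) (T : ℕ) (A : E2ERule) (m : ℝ → ℝ → ℕ) : Prop :=
  ∀ (D : Measure Str) [IsProbabilityMeasure D], ∀ f ∈ F, ∀ ε δ : ℝ,
    0 < ε → ε < 1 → 0 < δ → δ < 1 →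
      1 - δ ≤ (Measure.pi fun _ : Fin (m ε δ) => D).real
        {x | popError D f T (A (e2eSample f T x)) ≤ ε}

/-- The rule `A` learns `ete F T` from entire Chains-of-Thought with sample complexity `m`, in the
realizable setting. The predictor is evaluated on the final answer only. -/
def CoTLearnsWith (F : Set Generator) (T : ℕ) (A : CoTRule) (m : ℝ → ℝ → ℕ) : Prop :=
  ∀ (D : Measure Str) [IsProbabilityMeasure D], ∀ f ∈ F, ∀ ε δ : ℝ,
    0 < ε → ε < 1 → 0 < δ → δ < 1 →
      1 - δ ≤ (Measure.pi fun _ : Fin (m ε δ) => D).real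
        {x | popError D f T (A (cotSample f T x)) ≤ ε}

/-- `ete F T` is e2e-learnable with sample complexity `m`. -/
def E2ELearnable (F : Set Generator) (T : ℕ) (m : ℝ → ℝ → ℕ) : Prop :=
  ∃ A : E2ERule, E2ELearnsWith F T A m

/-- `ete F T` is CoT-learnable with sample complexity `m`. -/
def CoTLearnable (F : Set Generator) (T : ℕ) (m : ℝ → ℝ → ℕ) : Prop :=
  ∃ A : CoTRule, CoTLearnsWith F T A m

/-- `f` agrees with all the final answers in `S`. -/
def E2EConsistent (f : Generator) (T : ℕ) (S : List (Str × Bool)) : Prop :=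
  ∀ p ∈ S, ete f T p.1 = p.2

/-- `f` generates every string `z` in `S` from its input, which is `z` without its last `T`
tokens. -/
def CoTConsistent (f : Generator) (T : ℕ) (S : List Str) : Prop :=
  ∀ z ∈ S, z = cot f T (z.take (z.length - T))

/-- `A` implements the rule `Cons_e2e`: on every training set that some member of `F` is
consistent with, it returns `ete g T` for some consistent `g ∈ F`. -/
def IsE2EConsRule (F : Set Generator) (T : ℕ) (A : E2ERule) : Prop :=
  ∀ S, (∃ f ∈ F, E2EConsistent f T S) → ∃ g ∈ F, E2EConsistent g T S ∧ A S = ete g T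

/-- `A` implements the rule `Cons_CoT`. -/
def IsCoTConsRule (F : Set Generator) (T : ℕ) (A : CoTRule) : Prop :=
  ∀ S, (∃ f ∈ F, CoTConsistent f T S) → ∃ g ∈ F, CoTConsistent g T S ∧ A S = ete g T

/-!
A consistent rule errs by more than `ε` only if the sample misses the set of inputs on which its
hypothesis disagrees with the target, so it is enough that the sample is an `ε`-net for the
error sets of all hypotheses. The failure probability has two bounds. The union bound over the
class, which has only `2 ^ O(d ^ 2)` members since each of them is determined by the last `d`
symbols, gives the term `d ^ 2`. The `ε`-net theorem gives the other term once the traces of the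
error sets on `n` inputs are counted, and the Sauer–Shelah lemma does so whenever these traces
depend only on the values of the hypothesis on few strings. A hypothesis reproduces the target's
Chain-of-Thought on `x` iff it agrees with the target on the `T` prefixes that the target itself
produces, so `n * T` strings suffice for Chains-of-Thought. For final answers, the inputs
extended by every word of length less than `T` suffice, which makes at most `n * 2 ^ T` strings.
The VC dimension of the class is at most `d + 1`, because vectors all of whose labellings are
realized by half-spaces are linearly independent.
-/

section VCDimension

open Finset

variable {X : Type*} {F G : Set (X → Bool)} {D : ℕ}

/-- `F` has Vapnik–Chervonenkis dimension at most `D`: no set of more than `D` points is shattered,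
where a labelling of the points of `S` is given as the restriction of a function on `X`. -/
def VCDimLE (F : Set (X → Bool)) (D : ℕ) : Prop :=
  ∀ S : Finset X, (∀ y : X → Bool, ∃ f ∈ F, Set.EqOn f y S) → #S ≤ D

theorem VCDimLE.mono (hFG : F ⊆ G) (hG : VCDimLE G D) : VCDimLE F D := fun S hS =>
  hG S fun y => (hS y).imp fun _ hf => ⟨hFG hf.1, hf.2⟩

section HalfSpaces

variable {𝕜 E : Type*} [Field 𝕜] [LinearOrder 𝕜] [IsStrictOrderedRing 𝕜] [AddCommGroup E]
  [Module 𝕜 E]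

theorem linearIndependent_of_forall_exists_dual_nonneg_iff {ι : Type*} {v : ι → E}
    (h : ∀ P : Set ι, ∃ ℓ : Module.Dual 𝕜 E, ∀ i, 0 ≤ ℓ (v i) ↔ i ∈ P) :
    LinearIndependent 𝕜 v := by
  have hnonneg : ∀ (s : Finset ι) (c : ι → 𝕜), ∑ i ∈ s, c i • v i = 0 → ∀ i ∈ s, 0 ≤ c i := by
    intro s c hc i hi
    obtain ⟨ℓ, hℓ⟩ := h {i | 0 ≤ c i}
    have hsum : ∑ i ∈ s, c i * ℓ (v i) = 0 := by simpa using congrArg ℓ hc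
    have hterm : ∀ i ∈ s, 0 ≤ c i * ℓ (v i) := fun i _ => by
      rcases le_or_gt 0 (c i) with hci | hci
      · exact mul_nonneg hci ((hℓ i).2 hci)
      · exact mul_nonneg_of_nonpos_of_nonpos hci.le
          (not_le.1 fun hi => hci.not_ge ((hℓ i).1 hi)).le
    by_contra! hci
    have hℓi : ℓ (v i) < 0 := not_le.1 fun hi => hci.not_ge ((hℓ i).1 hi)
    exact (mul_pos_of_neg_of_neg hci hℓi).ne' ((sum_eq_zero_iff_of_nonneg hterm).1 hsum i hi)
  refine linearIndependent_iff'.2 fun s c hc i hi => le_antisymm ?_ (hnonneg s c hc i hi)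
  have hneg := hnonneg s (-c) (by simpa using hc) i hi
  simpa using hneg

theorem vcDimLE_setOf_exists_dual_nonneg_iff [FiniteDimensional 𝕜 E] (v : X → E) :
    VCDimLE {f | ∃ ℓ : Module.Dual 𝕜 E, ∀ x, f x = true ↔ 0 ≤ ℓ (v x)}
      (Module.finrank 𝕜 E) := by
  classical
  intro S hS
  have hli : LinearIndependent 𝕜 fun x : S => v x := by
    refine linearIndependent_of_forall_exists_dual_nonneg_iff fun P => ?_
    obtain ⟨f, ⟨ℓ, hℓ⟩, hfP⟩ := hS fun x => decide (x ∈ Subtype.val '' P)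
    exact ⟨ℓ, fun i => by simp [← hℓ, hfP i.2]⟩
  simpa using hli.fintype_card_le_finrank

end HalfSpaces

section SauerShelah

variable {γ : Type*} {S : Finset X} {s : (X → Bool) → γ}

theorem ncard_image_le_ncard_image_restrict (hs : DependsOn s (S : Set X)) :
    (s '' F).ncard ≤ ((S : Set X).domRestrict '' F).ncard := by
  have : Nonempty γ := ⟨s fun _ => false⟩
  obtain ⟨e, rfl⟩ := dependsOn_iff_exists_comp.1 hs
  rw [Set.image_comp]
  exact Set.ncard_image_le (Set.toFinite _)

open Classical in
/-- The Sauer–Shelah lemma. -/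
theorem VCDimLE.ncard_image_le (hF : VCDimLE F D) (hs : DependsOn s (S : Set X)) :
    (s '' F).ncard ≤ ∑ k ∈ Iic D, (#S).choose k := by
  set R : Finset (↥(S : Set X) → Bool) := (Set.toFinite ((S : Set X).domRestrict '' F)).toFinset
  let positives : (↥(S : Set X) → Bool) → Finset (S : Set X) := fun r => univ.filter fun x => r x
  have hinj : positives.Injective := fun r r' h => by
    funext x
    simpa [positives, ← Bool.eq_iff_iff] using congrArg (x ∈ ·) h
  have hdim : (R.image positives).vcDim ≤ D := by
    refine Finset.sup_le fun A hA => ?_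
    rw [← card_map (.subtype _)]
    refine hF _ fun y => ?_
    obtain ⟨u, hu, hAu⟩ := mem_shatterer.1 hA (t := A.filter fun x => y x) (filter_subset _ _)
    obtain ⟨_, hr, rfl⟩ := mem_image.1 hu
    obtain ⟨f, hf, rfl⟩ := (Set.Finite.mem_toFinset _).1 hr
    refine ⟨f, hf, fun x hx => ?_⟩
    obtain ⟨x, hxA, rfl⟩ := mem_map.1 hx
    have hx := Finset.ext_iff.1 hAu x
    simp only [mem_inter, mem_filter, positives, mem_univ, hxA, true_and] at hx
    exact Bool.eq_iff_iff.2 hx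
  calc (s '' F).ncard ≤ ((S : Set X).domRestrict '' F).ncard :=
        ncard_image_le_ncard_image_restrict hs
    _ = #(R.image positives) := by
        rw [card_image_of_injective _ hinj, Set.ncard_eq_toFinset_card _]
    _ ≤ #(R.image positives).shatterer := card_le_card_shatterer _
    _ ≤ ∑ k ∈ Iic (R.image positives).vcDim, (Fintype.card (S : Set X)).choose k :=
        card_shatterer_le_sum_vcDim
    _ ≤ ∑ k ∈ Iic D, (#S).choose k := by
        simpa using sum_le_sum_of_subset (Iic_subset_Iic.2 hdim)

end SauerShelah

theorem sum_Iic_choose_le_exp_mul_div_pow {n k : ℕ} (hk : 1 ≤ k) (hkn : k ≤ n) :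
    ((∑ i ∈ Iic k, n.choose i : ℕ) : ℝ) ≤ (Real.exp 1 * n / k) ^ k := by
  have hk0 : (0 : ℝ) < k := by exact_mod_cast hk
  have hn0 : (0 : ℝ) < n := by exact_mod_cast hk.trans hkn
  set q : ℝ := k / n with hq
  have hq0 : 0 < q := div_pos hk0 hn0
  have hq1 : q ≤ 1 := (div_le_one hn0).2 (by exact_mod_cast hkn)
  have hweighted : ((∑ i ∈ Iic k, n.choose i : ℕ) : ℝ) * q ^ k ≤ Real.exp k := by
    calc ((∑ i ∈ Iic k, n.choose i : ℕ) : ℝ) * q ^ k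
        = ∑ i ∈ Iic k, q ^ k * (n.choose i : ℝ) := by push_cast; rw [mul_comm, mul_sum]
      _ ≤ ∑ i ∈ Iic k, q ^ i * (n.choose i : ℝ) := sum_le_sum fun i hi =>
          mul_le_mul_of_nonneg_right (pow_le_pow_of_le_one hq0.le hq1 (mem_Iic.1 hi))
            (Nat.cast_nonneg _)
      _ ≤ ∑ i ∈ range (n + 1), q ^ i * (n.choose i : ℝ) :=
          sum_le_sum_of_subset_of_nonneg
            (fun i hi => mem_range.2 (by have := mem_Iic.1 hi; omega)) fun i _ _ => by positivity
      _ = (q + 1) ^ n := by simp [add_pow]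
      _ ≤ Real.exp q ^ n := by gcongr; exact Real.add_one_le_exp q
      _ = Real.exp k := by rw [← Real.exp_nat_mul, hq, mul_div_cancel₀ _ hn0.ne']
  calc ((∑ i ∈ Iic k, n.choose i : ℕ) : ℝ) ≤ Real.exp k / q ^ k :=
        (le_div_iff₀ (pow_pos hq0 k)).2 hweighted
    _ = (Real.exp 1 * n / k) ^ k := by
        rw [← Real.exp_one_pow, ← div_pow, hq, div_div_eq_mul_div]

end VCDimension

section EpsilonNet

open Finset ProbabilityTheory
open scoped ENNReal

variable {X : Type*} {m k : ℕ} {𝓑 : Set (Set X)} {B : Set X} {ε : ℝ}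

/-- The growth function of `𝓑`: the largest number of traces that `𝓑` leaves on a set of at most
`n` points. -/
noncomputable def growthFunction (𝓑 : Set (Set X)) (n : ℕ) : ℕ :=
  ⨆ S : {S : Finset X // #S ≤ n}, ((fun B => B ∩ (S : Set X)) '' 𝓑).ncard

theorem finite_image_inter (𝓑 : Set (Set X)) (S : Finset X) :
    ((fun B => B ∩ (S : Set X)) '' 𝓑).Finite :=
  S.finite_toSet.finite_subsets.subset (by rintro _ ⟨B, -, rfl⟩; exact Set.inter_subset_right)

theorem ncard_image_inter_le_growthFunction {S : Finset X} {n : ℕ} (hS : #S ≤ n) :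
    ((fun B => B ∩ (S : Set X)) '' 𝓑).ncard ≤ growthFunction 𝓑 n := by
  refine le_ciSup (f := fun S : {S : Finset X // #S ≤ n} =>
    ((fun B => B ∩ (S : Set X)) '' 𝓑).ncard) ⟨2 ^ n, ?_⟩ ⟨S, hS⟩
  rintro _ ⟨⟨S, hS⟩, rfl⟩
  calc ((fun B => B ∩ (S : Set X)) '' 𝓑).ncard ≤ (𝒫 (S : Set X)).ncard :=
        Set.ncard_le_ncard (by rintro _ ⟨B, -, rfl⟩; exact Set.inter_subset_right)
          S.finite_toSet.finite_subsets
    _ = 2 ^ #S := by rw [Set.ncard_powerset _ S.finite_toSet, Set.ncard_coe_finset]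
    _ ≤ 2 ^ n := Nat.pow_le_pow_right two_pos hS

theorem growthFunction_le {n K : ℕ}
    (h : ∀ S : Finset X, #S ≤ n → ((fun B => B ∩ (S : Set X)) '' 𝓑).ncard ≤ K) :
    growthFunction 𝓑 n ≤ K :=
  ciSup_le' fun S => h S S.2

open Classical in
/-- The indices of the sample points that lie in `B`. -/
noncomputable def hits (B : Set X) (y : Fin m → X) : Finset (Fin m) := {i | y i ∈ B}

theorem mem_hits {y : Fin m → X} {i : Fin m} : i ∈ hits B y ↔ y i ∈ B := by simp [hits]

theorem card_hits_eq_sum_indicator (B : Set X) (y : Fin m → X) :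
    (#(hits B y) : ℝ) = ∑ i, B.indicator (1 : X → ℝ) (y i) := by
  simp only [hits, Set.indicator, Pi.one_apply, sum_boole]

/-- The double samples for which the first half misses a set of `𝓑` that the second half hits at
least `k` times. -/
def missHit (𝓑 : Set (Set X)) (k m : ℕ) : Set (Fin m → X × X) :=
  {z | ∃ B ∈ 𝓑, (∀ i, (z i).1 ∉ B) ∧ k ≤ #(hits B fun i => (z i).2)}

/-- Exchange the two entries of `z i` for all `i` with `σ i = true`. -/
def swapPairs (σ : Fin m → Bool) (z : Fin m → X × X) : Fin m → X × X :=
  fun i => if σ i then (z i).swap else z i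

open Classical in
theorem card_swapPairs_mem_missHit_singleton_mul_le (B : Set X) (k : ℕ) (z : Fin m → X × X) :
    #{σ : Fin m → Bool | swapPairs σ z ∈ missHit {B} k m} * 2 ^ k ≤ 2 ^ m := by
  set E : Finset (Fin m → Bool) := {σ | swapPairs σ z ∈ missHit {B} k m} with hE
  have mem_E : ∀ σ, σ ∈ E ↔ (∀ i, (swapPairs σ z i).1 ∉ B) ∧
      k ≤ #(hits B fun i => (swapPairs σ z i).2) := fun σ => by simp [hE, missHit]
  rcases E.eq_empty_or_nonempty with hempty | ⟨τ, hτ⟩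
  · simp [hempty]
  set I := hits B fun i => (swapPairs τ z i).2
  have hk : k ≤ #I := ((mem_E τ).1 hτ).2
  -- If the second entry of a pair lies in `B`, then exchanging the pair moves it to the first half.
  have hagree : ∀ σ ∈ E, ∀ i ∈ I, σ i = τ i := fun σ hσ i hi => by
    have hmiss := ((mem_E σ).1 hσ).1 i
    have hhit := mem_hits.1 hi
    by_contra hne
    cases h : σ i <;> cases h' : τ i <;> simp_all [swapPairs]
  have hcard : #E ≤ Fintype.card ({i // i ∉ I} → Bool) := by
    rw [← card_univ]
    refine card_le_card_of_injOn (fun σ i => σ i) (fun _ _ => mem_univ _) fun σ hσ ρ hρ h => ?_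
    funext i
    by_cases hi : i ∈ I
    · rw [hagree σ hσ i hi, hagree ρ hρ i hi]
    · exact congrFun h ⟨i, hi⟩
  have hI : #I ≤ m := by simpa using card_le_univ I
  calc #E * 2 ^ k ≤ 2 ^ (m - #I) * 2 ^ #I := by
        refine Nat.mul_le_mul ?_ (Nat.pow_le_pow_right two_pos hk)
        simpa [Fintype.card_subtype_compl] using hcard
    _ = 2 ^ m := by rw [← pow_add, Nat.sub_add_cancel hI]

open Classical in
theorem card_swapPairs_mem_missHit_mul_le (𝓑 : Set (Set X)) (k : ℕ) (z : Fin m → X × X) :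
    #{σ : Fin m → Bool | swapPairs σ z ∈ missHit 𝓑 k m} * 2 ^ k ≤
      growthFunction 𝓑 (2 * m) * 2 ^ m := by
  let S : Finset X := univ.image (fun i => (z i).1) ∪ univ.image (fun i => (z i).2)
  have hS : #S ≤ 2 * m :=
    calc #S ≤ m + m := (card_union_le _ _).trans
          (add_le_add (card_image_le.trans_eq (by simp)) (card_image_le.trans_eq (by simp)))
      _ = 2 * m := (two_mul m).symm
  have hmem : ∀ σ i, (swapPairs σ z i).1 ∈ S ∧ (swapPairs σ z i).2 ∈ S := fun σ i => by
    cases h : σ i <;> simp [S, swapPairs, h]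
  let traces := (finite_image_inter 𝓑 S).toFinset
  have hcover : ({σ | swapPairs σ z ∈ missHit 𝓑 k m} : Finset (Fin m → Bool)) ⊆
      traces.biUnion fun B => {σ | swapPairs σ z ∈ missHit {B} k m} := by
    intro σ hσ
    obtain ⟨-, B, hB, hmiss, hhit⟩ := mem_filter.1 hσ
    refine mem_biUnion.2 ⟨B ∩ S, (Set.Finite.mem_toFinset _).2 ⟨B, hB, rfl⟩, mem_filter.2
      ⟨mem_univ _, B ∩ S, rfl, fun i hi => hmiss i hi.1, hhit.trans (card_le_card fun i hi => ?_)⟩⟩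
    exact mem_hits.2 ⟨mem_hits.1 hi, (hmem σ i).2⟩
  calc _ ≤ (∑ B ∈ traces, #{σ : Fin m → Bool | swapPairs σ z ∈ missHit {B} k m}) * 2 ^ k :=
        Nat.mul_le_mul_right _ ((card_le_card hcover).trans card_biUnion_le)
    _ ≤ ∑ _B ∈ traces, 2 ^ m := by
        rw [sum_mul]
        exact sum_le_sum fun B _ => card_swapPairs_mem_missHit_singleton_mul_le B k z
    _ = #traces * 2 ^ m := by rw [sum_const, smul_eq_mul]
    _ ≤ growthFunction 𝓑 (2 * m) * 2 ^ m := by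
        rw [← Set.ncard_eq_toFinset_card _ (finite_image_inter 𝓑 S)]
        exact Nat.mul_le_mul_right _ (ncard_image_inter_le_growthFunction hS)

variable [MeasurableSpace X]

theorem measurable_card_hits (hB : MeasurableSet B) :
    Measurable fun y : Fin m → X => (#(hits B y) : ℝ) := by
  simp only [card_hits_eq_sum_indicator]
  exact Finset.measurable_sum _ fun i _ =>
    (measurable_one.indicator hB).comp (measurable_pi_apply i)

theorem measurableSet_missHit (h𝓑 : 𝓑.Countable) (hmeas : ∀ B ∈ 𝓑, MeasurableSet B) (k : ℕ) :
    MeasurableSet (missHit 𝓑 k m) := by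
  have hunion : missHit 𝓑 k m =
      ⋃ B ∈ 𝓑, {z | (∀ i, (z i).1 ∉ B) ∧ (k : ℝ) ≤ #(hits B fun i => (z i).2)} := by
    ext z
    simp only [missHit, Set.mem_ofPred_eq, Set.mem_iUnion, exists_prop, Nat.cast_le]
  rw [hunion]
  refine .biUnion h𝓑 fun B hB => .inter ?_ ?_
  · change MeasurableSet {z : Fin m → X × X | ∀ i, (z i).1 ∉ B}
    rw [Set.ofPred_forall]
    exact .iInter fun i => ((measurable_pi_apply i).fst (hmeas B hB)).compl
  · exact measurableSet_le measurable_const ((measurable_card_hits (hmeas B hB)).comp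
      (measurable_pi_lambda _ fun i => (measurable_pi_apply i).snd))

variable (D : Measure X) [IsProbabilityMeasure D]

theorem measurePreserving_swapPairs (σ : Fin m → Bool) :
    MeasurePreserving (swapPairs σ) (Measure.pi fun _ : Fin m => D.prod D)
      (Measure.pi fun _ : Fin m => D.prod D) := by
  refine measurePreserving_pi (f := fun i p => if σ i then Prod.swap p else p) _ _ fun i => ?_
  by_cases h : σ i
  · simpa only [h, if_true] using Measure.measurePreserving_swap
  · simpa only [h, if_false] using! MeasurePreserving.id (D.prod D)

open Classical in
theorem measure_missHit_mul_le (h𝓑 : 𝓑.Countable) (hmeas : ∀ B ∈ 𝓑, MeasurableSet B) (k : ℕ) :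
    (Measure.pi fun _ : Fin m => D.prod D) (missHit 𝓑 k m) * 2 ^ k ≤
      growthFunction 𝓑 (2 * m) := by
  set ν := Measure.pi fun _ : Fin m => D.prod D
  have hZ : MeasurableSet (missHit 𝓑 k m) := measurableSet_missHit h𝓑 hmeas k
  have hswap (σ : Fin m → Bool) : MeasurePreserving (swapPairs σ) ν ν :=
    measurePreserving_swapPairs D σ
  have haverage : 2 ^ m * ν (missHit 𝓑 k m) =
      ∫⁻ z, #{σ : Fin m → Bool | swapPairs σ z ∈ missHit 𝓑 k m} ∂ν := by
    calc 2 ^ m * ν (missHit 𝓑 k m)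
        = ∑ σ : Fin m → Bool, ν (swapPairs σ ⁻¹' missHit 𝓑 k m) := by
          simp [fun σ => (hswap σ).measure_preimage hZ.nullMeasurableSet]
      _ = ∑ σ : Fin m → Bool, ∫⁻ z, (swapPairs σ ⁻¹' missHit 𝓑 k m).indicator 1 z ∂ν := by
          simp only [lintegral_indicator_one ((hswap _).measurable hZ)]
      _ = ∫⁻ z, ∑ σ : Fin m → Bool, (swapPairs σ ⁻¹' missHit 𝓑 k m).indicator 1 z ∂ν :=
          (lintegral_finsetSum _ fun σ _ =>
            measurable_one.indicator ((hswap σ).measurable hZ)).symm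
      _ = _ := by simp [Set.indicator_apply, sum_boole]
  have hbound : 2 ^ m * (ν (missHit 𝓑 k m) * 2 ^ k) ≤ 2 ^ m * growthFunction 𝓑 (2 * m) := by
    calc 2 ^ m * (ν (missHit 𝓑 k m) * 2 ^ k)
        = ∫⁻ z, #{σ : Fin m → Bool | swapPairs σ z ∈ missHit 𝓑 k m} * 2 ^ k ∂ν := by
          rw [← mul_assoc, haverage, lintegral_mul_const' _ _ (by simp)]
      _ ≤ ∫⁻ _, (growthFunction 𝓑 (2 * m) * 2 ^ m : ℝ≥0∞) ∂ν := lintegral_mono fun z => by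
          beta_reduce
          exact_mod_cast card_swapPairs_mem_missHit_mul_le 𝓑 k z
      _ = 2 ^ m * growthFunction 𝓑 (2 * m) := by simp [ν, mul_comm]
  exact (ENNReal.mul_le_mul_iff_right (by simp) (by simp)).1 hbound

theorem integral_card_hits (hB : MeasurableSet B) :
    ∫ y, (#(hits B y) : ℝ) ∂(Measure.pi fun _ : Fin m => D) = m * D.real B := by
  have hintegrable : Integrable (B.indicator (1 : X → ℝ)) D := (integrable_const 1).indicator hB
  have heval (i : Fin m) : ∫ y, B.indicator (1 : X → ℝ) (y i) ∂(Measure.pi fun _ : Fin m => D) =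
      D.real B := by
    rw [integral_comp_eval (X := fun _ => X) hintegrable.aestronglyMeasurable,
      integral_indicator_one hB]
  simp only [card_hits_eq_sum_indicator]
  rw [integral_finsetSum _ fun i _ => integrable_comp_eval (X := fun _ => X) hintegrable]
  simp [heval]

theorem variance_card_hits_le (hB : MeasurableSet B) :
    Var[fun y => (#(hits B y) : ℝ); Measure.pi fun _ : Fin m => D] ≤ m * D.real B := by
  have hmeas : Measurable (B.indicator (1 : X → ℝ)) := measurable_one.indicator hB
  have hLp : MemLp (B.indicator (1 : X → ℝ)) 2 D := (memLp_const 1).indicator hB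
  have hvar : Var[B.indicator (1 : X → ℝ); D] ≤ D.real B := by
    refine (variance_le_sub_mul_sub (a := 0) (b := 1) (.of_forall fun x => ?_)
      hmeas.aemeasurable).trans ?_
    · by_cases hx : x ∈ B <;> simp [hx]
    · rw [integral_indicator_one hB]
      nlinarith [sq_nonneg (D.real B)]
  have hsum : (fun y : Fin m → X => (#(hits B y) : ℝ)) =
      ∑ i, fun y => B.indicator (1 : X → ℝ) (y i) := by
    ext y
    simp [card_hits_eq_sum_indicator]
  rw [hsum, variance_sum_pi (X := fun _ => B.indicator 1) fun _ => hLp, sum_const, card_univ,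
    Fintype.card_fin, nsmul_eq_mul]
  gcongr

theorem measureReal_card_hits_lt_le (hB : MeasurableSet B) (hpos : 0 < m * D.real B) :
    (Measure.pi fun _ : Fin m => D).real {y | (#(hits B y) : ℝ) < m * D.real B / 2} ≤
      4 / (m * D.real B) := by
  set μ := Measure.pi fun _ : Fin m => D
  have hLp : MemLp (fun y : Fin m → X => (#(hits B y) : ℝ)) 2 μ :=
    .of_bound (measurable_card_hits hB).aestronglyMeasurable m (.of_forall fun y => by
      simpa using card_le_univ (hits B y))
  have hcheb := meas_ge_le_variance_div_sq hLp (half_pos hpos)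
  rw [integral_card_hits D hB] at hcheb
  have hvar := variance_card_hits_le (m := m) D hB
  refine ENNReal.toReal_le_of_le_ofReal (by positivity)
    ((measure_mono fun y hy => ?_).trans (hcheb.trans (ENNReal.ofReal_le_ofReal ?_)))
  · simp only [Set.mem_ofPred_eq] at hy ⊢
    rw [abs_sub_comm]
    exact le_abs.2 (.inl (by linarith))
  · rw [div_le_div_iff₀ (by positivity) hpos]
    calc _ ≤ m * D.real B * (m * D.real B) := by gcongr
      _ = _ := by ring

theorem half_le_measure_card_hits (hB : MeasurableSet B) (hε : ε < D.real B) (hm : 8 ≤ ε * m) :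
    1 / 2 ≤ (Measure.pi fun _ : Fin m => D) {y | ⌈ε * m / 2⌉₊ ≤ #(hits B y)} := by
  set μ := Measure.pi fun _ : Fin m => D
  have hle : ε * m ≤ m * D.real B := by rw [mul_comm]; gcongr
  have htail : μ.real {y | (#(hits B y) : ℝ) < m * D.real B / 2} ≤ 1 / 2 :=
    (measureReal_card_hits_lt_le D hB (by linarith)).trans
      ((div_le_div_iff₀ (by linarith) two_pos).2 (by linarith))
  have hcompl := probReal_compl_eq_one_sub (μ := μ) (measurableSet_lt (measurable_card_hits hB)
    (measurable_const (a := m * D.real B / 2)))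
  calc (1 / 2 : ℝ≥0∞) = ENNReal.ofReal (1 / 2) := by
        rw [ENNReal.ofReal_div_of_pos two_pos, ENNReal.ofReal_one, ENNReal.ofReal_ofNat]
    _ ≤ ENNReal.ofReal (μ.real {y | (#(hits B y) : ℝ) < m * D.real B / 2}ᶜ) :=
        ENNReal.ofReal_le_ofReal (by linarith)
    _ = μ {y | (#(hits B y) : ℝ) < m * D.real B / 2}ᶜ := ofReal_measureReal
    _ ≤ μ {y | ⌈ε * m / 2⌉₊ ≤ #(hits B y)} := measure_mono fun y hy => by
        simp only [Set.mem_compl_iff, Set.mem_ofPred_eq, not_lt] at hy ⊢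
        exact Nat.ceil_le.2 (by linarith)

/-- The samples of size `m` that are not `ε`-nets of `𝓑`, that is, that miss a set of `𝓑` of measure
more than `ε`. -/
def nonNets (D : Measure X) (𝓑 : Set (Set X)) (ε : ℝ) (m : ℕ) : Set (Fin m → X) :=
  {x | ∃ B ∈ 𝓑, ε < D.real B ∧ ∀ i, x i ∉ B}

/-- Symmetrization: the second half of a double sample serves as an empirical stand-in for `D`. -/
theorem measure_nonNets_mul_half_le (h𝓑 : 𝓑.Countable) (hmeas : ∀ B ∈ 𝓑, MeasurableSet B)
    (hm : 8 ≤ ε * m) :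
    (Measure.pi fun _ : Fin m => D) (nonNets D 𝓑 ε m) * (1 / 2) ≤
      (Measure.pi fun _ : Fin m => D.prod D) (missHit 𝓑 ⌈ε * m / 2⌉₊ m) := by
  set μ := Measure.pi fun _ : Fin m => D
  set k := ⌈ε * m / 2⌉₊
  let Z : Set ((Fin m → X) × (Fin m → X)) := {p | (fun i => (p.1 i, p.2 i)) ∈ missHit 𝓑 k m}
  have hZ : MeasurableSet Z := (measurableSet_missHit h𝓑 hmeas k).preimage (by fun_prop)
  have hfiber : nonNets D 𝓑 ε m ⊆ {x | 1 / 2 ≤ μ (Prod.mk x ⁻¹' Z)} := by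
    rintro x ⟨B, hB, hεB, hx⟩
    exact (half_le_measure_card_hits D (hmeas B hB) hεB hm).trans
      (measure_mono fun y hy => ⟨B, hB, hx, hy⟩)
  calc μ (nonNets D 𝓑 ε m) * (1 / 2) ≤ 1 / 2 * μ {x | 1 / 2 ≤ μ (Prod.mk x ⁻¹' Z)} := by
        rw [mul_comm]
        gcongr
    _ ≤ ∫⁻ x, μ (Prod.mk x ⁻¹' Z) ∂μ :=
        mul_meas_ge_le_lintegral (measurable_measure_prodMk_left hZ) _
    _ = μ.prod μ Z := (Measure.prod_apply hZ).symm
    _ = _ := by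
        rw [← (measurePreserving_arrowProdEquivProdArrow X X (Fin m) (fun _ => D)
          (fun _ => D)).measure_preimage hZ.nullMeasurableSet]
        rfl

/-- The `ε`-net theorem of Haussler and Welzl. -/
theorem measureReal_nonNets_le_growthFunction (h𝓑 : 𝓑.Countable)
    (hmeas : ∀ B ∈ 𝓑, MeasurableSet B) (hm : 8 ≤ ε * m) :
    (Measure.pi fun _ : Fin m => D).real (nonNets D 𝓑 ε m) ≤
      2 * growthFunction 𝓑 (2 * m) / 2 ^ ⌈ε * m / 2⌉₊ := by
  set μ := Measure.pi fun _ : Fin m => D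
  have hENNReal : μ (nonNets D 𝓑 ε m) * (1 / 2) * 2 ^ ⌈ε * m / 2⌉₊ ≤ growthFunction 𝓑 (2 * m) :=
    (mul_le_mul_left (measure_nonNets_mul_half_le D h𝓑 hmeas hm) _).trans
      (measure_missHit_mul_le D h𝓑 hmeas _)
  have hreal : μ.real (nonNets D 𝓑 ε m) * (1 / 2) * 2 ^ ⌈ε * m / 2⌉₊ ≤
      growthFunction 𝓑 (2 * m) := by
    simpa [Measure.real] using ENNReal.toReal_mono (by simp) hENNReal
  rw [le_div_iff₀ (by positivity)]
  linarith

theorem measureReal_forall_notMem (hB : MeasurableSet B) :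
    (Measure.pi fun _ : Fin m => D).real {x | ∀ i, x i ∉ B} = (1 - D.real B) ^ m := by
  have hset : {x : Fin m → X | ∀ i, x i ∉ B} = Set.univ.pi fun _ => Bᶜ := by ext x; simp
  rw [hset, measureReal_def, Measure.pi_pi, prod_const, ENNReal.toReal_pow, ← measureReal_def,
    probReal_compl_eq_one_sub hB, card_univ, Fintype.card_fin]

theorem measureReal_nonNets_le_ncard_mul_exp (h𝓑 : 𝓑.Finite)
    (hmeas : ∀ B ∈ 𝓑, MeasurableSet B) :
    (Measure.pi fun _ : Fin m => D).real (nonNets D 𝓑 ε m) ≤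
      𝓑.ncard * Real.exp (-(ε * m)) := by
  set μ := Measure.pi fun _ : Fin m => D
  have hmiss : ∀ B ∈ 𝓑, μ.real {x | ε < D.real B ∧ ∀ i, x i ∉ B} ≤ Real.exp (-(ε * m)) := by
    intro B hB
    by_cases hεB : ε < D.real B
    · have hp : 0 ≤ 1 - D.real B := sub_nonneg.2 measureReal_le_one
      calc μ.real {x | ε < D.real B ∧ ∀ i, x i ∉ B} = (1 - D.real B) ^ m := by
            simp only [hεB, true_and, μ, measureReal_forall_notMem D (hmeas B hB)]
        _ ≤ Real.exp (-ε) ^ m := by gcongr; linarith [Real.add_one_le_exp (-ε)]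
        _ = Real.exp (-(ε * m)) := by rw [← Real.exp_nat_mul]; ring_nf
    · simp only [hεB, false_and, Set.ofPred_false, measureReal_empty]
      positivity
  calc μ.real (nonNets D 𝓑 ε m)
      ≤ μ.real (⋃ B ∈ h𝓑.toFinset, {x | ε < D.real B ∧ ∀ i, x i ∉ B}) :=
        measureReal_mono (fun x ⟨B, hB, hx⟩ => by
          simp only [Set.mem_iUnion]; exact ⟨B, h𝓑.mem_toFinset.2 hB, hx⟩) (measure_ne_top _ _)
    _ ≤ ∑ B ∈ h𝓑.toFinset, μ.real {x | ε < D.real B ∧ ∀ i, x i ∉ B} :=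
        measureReal_biUnion_finset_le _ _
    _ ≤ ∑ _B ∈ h𝓑.toFinset, Real.exp (-(ε * m)) :=
        sum_le_sum fun B hB => hmiss B (h𝓑.mem_toFinset.1 hB)
    _ = 𝓑.ncard * Real.exp (-(ε * m)) := by
        rw [sum_const, nsmul_eq_mul, Set.ncard_eq_toFinset_card _ h𝓑]

end EpsilonNet

section ChainOfThought

open Finset

theorem cot_succ (f : Generator) (t : ℕ) (x : Str) :
    cot f (t + 1) x = cot f t x ++ [f (cot f t x)] :=
  Function.iterate_succ_apply' _ _ _

theorem exists_cot_eq_append (f : Generator) (t : ℕ) (x : Str) :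
    ∃ u : Str, u.length = t ∧ cot f t x = x ++ u := by
  induction t with
  | zero => exact ⟨[], rfl, by simp [cot]⟩
  | succ t ih =>
    obtain ⟨u, hu, h⟩ := ih
    exact ⟨u ++ [f (x ++ u)], by simp [hu], by simp [cot_succ, h]⟩

theorem take_length_sub_cot (f : Generator) (t : ℕ) (x : Str) :
    (cot f t x).take ((cot f t x).length - t) = x := by
  obtain ⟨u, rfl, h⟩ := exists_cot_eq_append f t x
  simp [h]

theorem cot_eq_iff (f g : Generator) (T : ℕ) (x : Str) :
    cot g T x = cot f T x ↔ ∀ t < T, g (cot f t x) = f (cot f t x) := by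
  induction T with
  | zero => simp [cot]
  | succ T ih =>
    rw [Nat.forall_lt_succ_right, ← ih, cot_succ, cot_succ]
    constructor
    · intro h
      obtain ⟨hinit, hlast⟩ := List.append_inj' h rfl
      exact ⟨hinit, by simpa [hinit] using hlast⟩
    · rintro ⟨hinit, hlast⟩
      rw [hinit, hlast]

/-- The set of all words of length `t`. -/
def words (t : ℕ) : Finset Str :=
  univ.map ⟨List.Vector.toList (α := Bool) (n := t), List.Vector.toList_injective⟩

theorem mem_words {t : ℕ} {u : Str} : u ∈ words t ↔ u.length = t := by
  simp only [words, mem_map, mem_univ, true_and, Function.Embedding.coeFn_mk]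
  exact ⟨fun ⟨v, hv⟩ => hv ▸ v.toList_length, fun hu => ⟨⟨u, hu⟩, rfl⟩⟩

theorem card_words (t : ℕ) : #(words t) = 2 ^ t := by
  rw [words, card_map, card_univ, card_vector, Fintype.card_bool]

theorem card_biUnion_range_words_le (T : ℕ) : #((range T).biUnion words) ≤ 2 ^ T := by
  calc #((range T).biUnion words) ≤ ∑ t ∈ range T, 2 ^ t :=
        card_biUnion_le.trans_eq (sum_congr rfl fun t _ => card_words t)
    _ = 2 ^ T - 1 := by simpa using Nat.geomSum_eq le_rfl T
    _ ≤ 2 ^ T := Nat.sub_le _ _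

variable {F : Set Generator} {D : ℕ}

theorem VCDimLE.ncard_restrictToLength_le (hF : VCDimLE F D) (n : ℕ) :
    (restrictToLength F n).ncard ≤ ∑ k ∈ Iic D, Nat.choose (2 ^ n) k := by
  rw [← card_words]
  exact hF.ncard_image_le (S := words n) fun f g h =>
    funext fun v => h _ (mem_words.2 v.toList_length)

/-- The sets on which the final answers of the members of `F` differ from those of `f`. -/
def eteErrorSets (F : Set Generator) (f : Generator) (T : ℕ) : Set (Set Str) :=
  (fun g : Generator => {x | ete g T x ≠ ete f T x}) '' F

/-- The sets on which the Chains-of-Thought of the members of `F` differ from those of `f`. -/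
def cotErrorSets (F : Set Generator) (f : Generator) (T : ℕ) : Set (Set Str) :=
  (fun g : Generator => {x | cot g T x ≠ cot f T x}) '' F

theorem growthFunction_cotErrorSets_le (hF : VCDimLE F D) (f : Generator) (T n : ℕ) :
    growthFunction (cotErrorSets F f T) n ≤ ∑ k ∈ Iic D, (n * T).choose k := by
  refine growthFunction_le fun S hS => ?_
  let prefixes : Finset Str := image₂ (fun x t => cot f t x) S (range T)
  have hcard : #prefixes ≤ n * T :=
    (card_image₂_le _ _ _).trans (by simpa using Nat.mul_le_mul_right T hS)
  have hdep : DependsOn (fun g : Generator => {x | cot g T x ≠ cot f T x} ∩ (S : Set Str))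
      (prefixes : Set Str) := by
    intro g g' h
    ext x
    simp only [Set.mem_inter_iff, Set.mem_ofPred_eq, and_congr_left_iff, ne_eq, not_iff_not,
      cot_eq_iff]
    refine fun hx => forall₂_congr fun t ht => ?_
    rw [h _ (mem_image₂_of_mem hx (mem_range.2 ht))]
  rw [cotErrorSets, Set.image_image]
  exact (hF.ncard_image_le hdep).trans (sum_le_sum fun k _ => Nat.choose_le_choose k hcard)

theorem growthFunction_eteErrorSets_le (hF : VCDimLE F D) (f : Generator) (T n : ℕ) :
    growthFunction (eteErrorSets F f T) n ≤ ∑ k ∈ Iic D, (n * 2 ^ T).choose k := by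
  refine growthFunction_le fun S hS => ?_
  let extensions : Finset Str := image₂ (· ++ ·) S ((range T).biUnion words)
  have hcard : #extensions ≤ n * 2 ^ T :=
    (card_image₂_le _ _ _).trans (Nat.mul_le_mul hS (card_biUnion_range_words_le T))
  have hdep : DependsOn (fun g : Generator => {x | ete g T x ≠ ete f T x} ∩ (S : Set Str))
      (extensions : Set Str) := by
    intro g g' h
    have hcot : ∀ x ∈ S, cot g T x = cot g' T x := fun x hx => by
      refine (cot_eq_iff g' g T x).2 fun t ht => ?_
      obtain ⟨u, rfl, hu⟩ := exists_cot_eq_append g' t x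
      rw [hu]
      exact h _ (mem_image₂_of_mem hx (mem_biUnion.2 ⟨_, mem_range.2 ht, mem_words.2 rfl⟩))
    ext x
    simp only [Set.mem_inter_iff, Set.mem_ofPred_eq, and_congr_left_iff, ete]
    intro hx
    rw [hcot x hx]
  rw [eteErrorSets, Set.image_image]
  exact (hF.ncard_image_le hdep).trans (sum_le_sum fun k _ => Nat.choose_le_choose k hcard)

end ChainOfThought

section LinearThresholds

open Finset

variable {d : ℕ}

theorem vcDimLE_linClass (d : ℕ) : VCDimLE (linClass d) (d + 1) := by
  let v : Str → (Fin d → ℝ) × ℝ := fun x => (fun i => bit (x.reverse.getD i false), 1)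
  have hfinrank : Module.finrank ℝ ((Fin d → ℝ) × ℝ) = d + 1 := by simp
  rw [← hfinrank]
  refine VCDimLE.mono ?_ (vcDimLE_setOf_exists_dual_nonneg_iff (𝕜 := ℝ) v)
  rintro _ ⟨w, b, rfl⟩
  refine ⟨(Fintype.linearCombination ℝ fun i => w i.rev).coprod (.toSpanSingleton ℝ ℝ b),
    fun x => ?_⟩
  simp [linThreshold, v, Fintype.linearCombination_apply, mul_comm]

theorem injOn_linClass_restrict (d : ℕ) :
    Set.InjOn (fun (f : Generator) (v : List.Vector Bool d) => f v.toList) (linClass d) := by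
  let lastTokens : Str → List.Vector Bool d := fun x =>
    ⟨(List.ofFn fun i : Fin d => x.reverse.getD i false).reverse, by simp⟩
  have hlast : ∀ f ∈ linClass d, ∀ x, f (lastTokens x).toList = f x := by
    rintro _ ⟨w, b, rfl⟩ x
    simp only [linThreshold, lastTokens, List.Vector.toList_mk, List.reverse_reverse]
    congr! 5 with i
    simp
  intro f hf g hg hfg
  funext x
  rw [← hlast f hf, ← hlast g hg]
  exact congrFun hfg _

theorem finite_linClass (d : ℕ) : (linClass d).Finite :=
  .of_finite_image (Set.toFinite _) (injOn_linClass_restrict d)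

theorem ncard_restrictToLength_linClass_le (d : ℕ) :
    ((restrictToLength (linClass d) d).ncard : ℝ) ≤ (2 * Real.exp 1 * 2 ^ d) ^ (d + 1) := by
  calc ((restrictToLength (linClass d) d).ncard : ℝ)
      ≤ ((∑ k ∈ Iic (d + 1), Nat.choose (2 ^ d) k : ℕ) : ℝ) :=
        Nat.cast_le.2 ((vcDimLE_linClass d).ncard_restrictToLength_le d)
    _ ≤ (Real.exp 1 * (2 ^ d : ℕ) / (d + 1 : ℕ)) ^ (d + 1) :=
        sum_Iic_choose_le_exp_mul_div_pow d.succ_pos Nat.lt_two_pow_self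
    _ ≤ (Real.exp 1 * (2 ^ d : ℕ)) ^ (d + 1) := by
        gcongr
        exact div_le_self (by positivity) (by exact_mod_cast d.succ_pos)
    _ ≤ (2 * Real.exp 1 * 2 ^ d) ^ (d + 1) := by
        push_cast
        gcongr
        linarith [Real.exp_pos 1]

theorem ncard_restrictToLength_linClass_le_two_pow (hd : 1 ≤ d) :
    (restrictToLength (linClass d) d).ncard ≤ 2 ^ (8 * d ^ 2) := by
  have hreal : ((restrictToLength (linClass d) d).ncard : ℝ) ≤ 2 ^ (8 * d ^ 2) := by
    calc ((restrictToLength (linClass d) d).ncard : ℝ)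
        ≤ (2 * Real.exp 1 * 2 ^ d) ^ (d + 1) := ncard_restrictToLength_linClass_le d
      _ ≤ (2 ^ 3 * 2 ^ d) ^ (d + 1) := by
          gcongr
          linarith [Real.exp_one_lt_d9]
      _ = 2 ^ ((3 + d) * (d + 1)) := by rw [← pow_add, ← pow_mul]
      _ ≤ 2 ^ (8 * d ^ 2) := pow_le_pow_right₀ one_le_two (by nlinarith)
  exact_mod_cast hreal

theorem ncard_linClass_le_two_pow (hd : 1 ≤ d) : (linClass d).ncard ≤ 2 ^ (8 * d ^ 2) :=
  (injOn_linClass_restrict d).ncard_image.ge.trans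
    (ncard_restrictToLength_linClass_le_two_pow hd)

theorem log_ncard_image_linClass_le {γ : Type*} (s : Generator → γ) (hd : 1 ≤ d) :
    Real.log (s '' linClass d).ncard ≤ 6 * d ^ 2 := by
  have hcard : ((s '' linClass d).ncard : ℝ) ≤ 2 ^ (8 * d ^ 2) := by
    exact_mod_cast (Set.ncard_image_le (finite_linClass d)).trans (ncard_linClass_le_two_pow hd)
  have hpos : 0 < (s '' linClass d).ncard :=
    (Set.ncard_pos ((finite_linClass d).image s)).2 (Set.Nonempty.image s ⟨_, 0, 0, rfl⟩)
  calc Real.log (s '' linClass d).ncard ≤ Real.log (2 ^ (8 * d ^ 2)) :=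
        Real.log_le_log (Nat.cast_pos.2 hpos) hcard
    _ = 8 * Real.log 2 * d ^ 2 := by rw [Real.log_pow]; push_cast; ring
    _ ≤ 6 * d ^ 2 := by gcongr; linarith [Real.log_two_lt_d9]

end LinearThresholds

section SampleSize

open Finset

variable {v N m : ℕ} {ε δ : ℝ}

theorem log_two_le_log_two_mul (hN : 1 ≤ N) : Real.log 2 ≤ Real.log (2 * N) :=
  Real.log_le_log two_pos (by simpa using (Nat.one_le_cast (α := ℝ)).2 hN)

theorem log_two_le_log_two_div (hε : 0 < ε) (hε1 : ε < 1) : Real.log 2 ≤ Real.log (2 / ε) :=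
  Real.log_le_log two_pos ((le_div_iff₀ hε).2 (by linarith))

theorem log_one_div_nonneg (hδ : 0 < δ) (hδ1 : δ < 1) : 0 ≤ Real.log (1 / δ) :=
  Real.log_nonneg ((one_le_div hδ).2 hδ1.le)

theorem exp_neg_log_one_div (hδ : 0 < δ) : Real.exp (-Real.log (1 / δ)) = δ := by
  rw [one_div, Real.log_inv, neg_neg, Real.exp_log hδ]

theorem half_mul_le_mul_log_mul_log (hN : 1 ≤ N) (hε : 0 < ε) (hε1 : ε < 1) (v : ℕ) :
    0.48 * v ≤ v * Real.log (2 * N) * Real.log (2 / ε) := by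
  have ha := log_two_le_log_two_mul hN
  have hb := log_two_le_log_two_div hε hε1
  have hlog2 := Real.log_two_gt_d9
  have hab : 0.48 ≤ Real.log (2 * N) * Real.log (2 / ε) := by nlinarith
  rw [mul_assoc, mul_comm 0.48]
  gcongr

theorem mul_log_exp_mul_div_le (hv : 1 ≤ v) (hN : 1 ≤ N) (hm : 0 < m) (hε : 0 < ε) (hε1 : ε < 1) :
    v * Real.log (Real.exp 1 * (2 * m * N : ℕ) / v) ≤
      ε * m / 8 + 6 * (v * Real.log (2 * N) * Real.log (2 / ε)) := by
  have ha := log_two_le_log_two_mul hN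
  have hb := log_two_le_log_two_div hε hε1
  have hlog2 := Real.log_two_gt_d9
  set a := Real.log (2 * N) with ha_def
  set b := Real.log (2 / ε) with hb_def
  have hu : 0 < ε * m / (8 * v) := by positivity
  have hfactor : Real.exp 1 * (2 * m * N : ℕ) / v =
      ε * m / (8 * v) * (2 * N * (2 / ε) * (Real.exp 1 * 2 ^ 2)) := by
    push_cast; field_simp; ring
  have hlog : Real.log (Real.exp 1 * (2 * m * N : ℕ) / v) ≤
      ε * m / (8 * v) + (a + b + 2 * Real.log 2) := by
    have hlogu := Real.log_le_sub_one_of_pos hu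
    rw [hfactor, Real.log_mul hu.ne' (by positivity), Real.log_mul (by positivity) (by positivity),
      Real.log_mul (by positivity : (2 * N : ℝ) ≠ 0) (by positivity),
      Real.log_mul (Real.exp_pos 1).ne' (by positivity), Real.log_exp, Real.log_pow, ← ha_def,
      ← hb_def]
    push_cast
    linarith
  have hab : a + b + 2 * Real.log 2 ≤ 6 * (a * b) := by
    nlinarith [mul_nonneg (sub_nonneg.2 ha) (sub_nonneg.2 hb)]
  calc v * Real.log (Real.exp 1 * (2 * m * N : ℕ) / v)
      ≤ v * (ε * m / (8 * v) + 6 * (a * b)) := by gcongr; linarith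
    _ = ε * m / 8 + 6 * (v * a * b) := by field_simp

theorem two_mul_pow_div_two_pow_le (hv : 1 ≤ v) (hN : 1 ≤ N) (hm : 0 < m) (hε : 0 < ε)
    (hε1 : ε < 1) (hδ : 0 < δ) (hδ1 : δ < 1)
    (hεm : 40 * (v * Real.log (2 * N) * Real.log (2 / ε) + Real.log (1 / δ)) ≤ ε * m)
    (hεm' : 19 ≤ ε * m) :
    2 * (Real.exp 1 * (2 * m * N : ℕ) / v) ^ v / 2 ^ ⌈ε * m / 2⌉₊ ≤ δ := by
  have hlogx := mul_log_exp_mul_div_le hv hN hm hε hε1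
  have hlogδ := log_one_div_nonneg hδ hδ1
  have hlog2 := Real.log_two_gt_d9
  have hlog2' := Real.log_two_lt_d9
  have hk : ε * m / 2 * 0.69 ≤ ⌈ε * m / 2⌉₊ * Real.log 2 := by
    gcongr
    · exact Nat.le_ceil _
    · linarith
  set x := Real.exp 1 * (2 * m * N : ℕ) / v
  set k := ⌈ε * m / 2⌉₊
  have hx : 0 < x := by positivity
  calc 2 * x ^ v / 2 ^ k
      = Real.exp (Real.log 2 + v * Real.log x - k * Real.log 2) := by
        rw [Real.exp_sub, Real.exp_add, Real.exp_nat_mul, Real.exp_nat_mul, Real.exp_log hx,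
          Real.exp_log two_pos]
    _ ≤ Real.exp (-Real.log (1 / δ)) := by
        gcongr
        linarith
    _ = δ := exp_neg_log_one_div hδ

variable {X : Type*} [MeasurableSpace X] (D : Measure X) [IsProbabilityMeasure D] {𝓑 : Set (Set X)}

theorem measureReal_nonNets_le_of_log_ncard_le (h𝓑 : 𝓑.Finite) (hmeas : ∀ B ∈ 𝓑, MeasurableSet B)
    (hδ : 0 < δ) (hεm : Real.log 𝓑.ncard + Real.log (1 / δ) ≤ ε * m) :
    (Measure.pi fun _ : Fin m => D).real (nonNets D 𝓑 ε m) ≤ δ :=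
  calc (Measure.pi fun _ : Fin m => D).real (nonNets D 𝓑 ε m)
      ≤ 𝓑.ncard * Real.exp (-(ε * m)) := measureReal_nonNets_le_ncard_mul_exp D h𝓑 hmeas
    _ ≤ Real.exp (Real.log 𝓑.ncard) * Real.exp (-(ε * m)) := by
        gcongr
        exact Real.le_exp_log _
    _ ≤ Real.exp (-Real.log (1 / δ)) := by
        rw [← Real.exp_add]
        gcongr
        linarith
    _ = δ := exp_neg_log_one_div hδ

theorem measureReal_nonNets_le_of_growthFunction_le (h𝓑 : 𝓑.Countable)
    (hmeas : ∀ B ∈ 𝓑, MeasurableSet B)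
    (hgrowth : ∀ n, growthFunction 𝓑 n ≤ ∑ k ∈ Iic v, (n * N).choose k)
    (hv : 1 ≤ v) (hN : 1 ≤ N) (hε : 0 < ε) (hε1 : ε < 1) (hδ : 0 < δ) (hδ1 : δ < 1)
    (hεm : 40 * (v * Real.log (2 * N) * Real.log (2 / ε) + Real.log (1 / δ)) ≤ ε * m) :
    (Measure.pi fun _ : Fin m => D).real (nonNets D 𝓑 ε m) ≤ δ := by
  have hlogδ := log_one_div_nonneg hδ hδ1
  have hv' : (1 : ℝ) ≤ v := by exact_mod_cast hv
  have hεm' : 19 * v ≤ ε * m := by linarith [half_mul_le_mul_log_mul_log hN hε hε1 v]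
  have hvm : v ≤ m := by
    have : (v : ℝ) ≤ m := by nlinarith [mul_le_of_le_one_left m.cast_nonneg hε1.le]
    exact_mod_cast this
  have hvmN : v ≤ 2 * m * N := by nlinarith
  calc (Measure.pi fun _ : Fin m => D).real (nonNets D 𝓑 ε m)
      ≤ 2 * growthFunction 𝓑 (2 * m) / 2 ^ ⌈ε * m / 2⌉₊ :=
        measureReal_nonNets_le_growthFunction D h𝓑 hmeas (by linarith)
    _ ≤ 2 * (Real.exp 1 * (2 * m * N : ℕ) / v) ^ v / 2 ^ ⌈ε * m / 2⌉₊ := by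
        gcongr
        exact (Nat.cast_le.2 (hgrowth _)).trans (sum_Iic_choose_le_exp_mul_div_pow hv hvmN)
    _ ≤ δ := two_mul_pow_div_two_pow_le hv hN (hv.trans hvm) hε hε1 hδ hδ1 hεm (by linarith)

theorem measureReal_nonNets_le (h𝓑 : 𝓑.Finite) (hmeas : ∀ B ∈ 𝓑, MeasurableSet B)
    (hgrowth : ∀ n, growthFunction 𝓑 n ≤ ∑ k ∈ Iic v, (n * N).choose k)
    (hv : 1 ≤ v) (hN : 1 ≤ N) (hε : 0 < ε) (hε1 : ε < 1) (hδ : 0 < δ) (hδ1 : δ < 1)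
    (hεm : 40 * (min (Real.log 𝓑.ncard) (v * Real.log (2 * N) * Real.log (2 / ε)) +
      Real.log (1 / δ)) ≤ ε * m) :
    (Measure.pi fun _ : Fin m => D).real (nonNets D 𝓑 ε m) ≤ δ := by
  rcases min_choice (Real.log 𝓑.ncard) (v * Real.log (2 * N) * Real.log (2 / ε)) with h | h <;>
    rw [h] at hεm
  · refine measureReal_nonNets_le_of_log_ncard_le D h𝓑 hmeas hδ ?_
    linarith [Real.log_natCast_nonneg 𝓑.ncard, log_one_div_nonneg hδ hδ1]
  · exact measureReal_nonNets_le_of_growthFunction_le D h𝓑.countable hmeas hgrowth hv hN hε hε1 hδ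
      hδ1 hεm

end SampleSize

section Learning

open Finset

variable {F : Set Generator} {T : ℕ}

theorem exists_isE2EConsRule (F : Set Generator) (T : ℕ) : ∃ A, IsE2EConsRule F T A := by
  classical
  exact ⟨fun S => if h : ∃ f ∈ F, E2EConsistent f T S then ete h.choose T else fun _ => false,
    fun S h => ⟨h.choose, h.choose_spec.1, h.choose_spec.2, by simp only [dif_pos h]⟩⟩

theorem exists_isCoTConsRule (F : Set Generator) (T : ℕ) : ∃ A, IsCoTConsRule F T A := by
  classical
  exact ⟨fun S => if h : ∃ f ∈ F, CoTConsistent f T S then ete h.choose T else fun _ => false,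
    fun S h => ⟨h.choose, h.choose_spec.1, h.choose_spec.2, by simp only [dif_pos h]⟩⟩

theorem IsE2EConsRule.popError_le {A : E2ERule} (hA : IsE2EConsRule F T A) {D : Measure Str}
    {f : Generator} (hf : f ∈ F) {ε : ℝ} {m : ℕ} {x : Fin m → Str}
    (hx : x ∉ nonNets D (eteErrorSets F f T) ε m) :
    popError D f T (A (e2eSample f T x)) ≤ ε := by
  obtain ⟨g, hg, hcons, hAg⟩ := hA (e2eSample f T x) ⟨f, hf, fun p hp => by
    obtain ⟨i, rfl⟩ := (List.mem_ofFn' _ _).1 hp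
    rfl⟩
  rw [hAg]
  by_contra! herr
  exact hx ⟨_, ⟨g, hg, rfl⟩, herr, fun i hi => hi (hcons _ ((List.mem_ofFn' _ _).2 ⟨i, rfl⟩))⟩

theorem IsCoTConsRule.popError_le {A : CoTRule} (hA : IsCoTConsRule F T A) {D : Measure Str}
    [IsFiniteMeasure D] {f : Generator} (hf : f ∈ F) {ε : ℝ} {m : ℕ} {x : Fin m → Str}
    (hx : x ∉ nonNets D (cotErrorSets F f T) ε m) :
    popError D f T (A (cotSample f T x)) ≤ ε := by
  obtain ⟨g, hg, hcons, hAg⟩ := hA (cotSample f T x) ⟨f, hf, fun p hp => by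
    obtain ⟨i, rfl⟩ := (List.mem_ofFn' _ _).1 hp
    rw [take_length_sub_cot]⟩
  rw [hAg]
  by_contra! herr
  refine hx ⟨_, ⟨g, hg, rfl⟩, herr.trans_le (measureReal_mono fun x hne hcot => hne ?_),
    fun i hi => hi ?_⟩
  · rw [ete, ete, hcot]
  · have hchain := hcons (cot f T (x i)) ((List.mem_ofFn' _ _).2 ⟨i, rfl⟩)
    rwa [take_length_sub_cot, eq_comm] at hchain

theorem one_sub_le_measureReal_of_compl_subset {Ω : Type*} [MeasurableSpace Ω] {μ : Measure Ω}
    [IsProbabilityMeasure μ] {δ : ℝ} {bad good : Set Ω} (hbad : μ.real bad ≤ δ)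
    (hgood : badᶜ ⊆ good) : 1 - δ ≤ μ.real good := by
  have hone : 1 ≤ μ.real bad + μ.real good :=
    calc 1 = μ.real (bad ∪ badᶜ) := by rw [Set.union_compl_self, probReal_univ]
      _ ≤ μ.real bad + μ.real badᶜ := measureReal_union_le _ _
      _ ≤ μ.real bad + μ.real good := by gcongr; exact measure_ne_top _ _
  linarith

theorem IsE2EConsRule.e2eLearnsWith {A : E2ERule} (hA : IsE2EConsRule F T A) {m : ℝ → ℝ → ℕ}
    (hm : ∀ (D : Measure Str) [IsProbabilityMeasure D], ∀ f ∈ F, ∀ ε δ : ℝ,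
      0 < ε → ε < 1 → 0 < δ → δ < 1 → (Measure.pi fun _ : Fin (m ε δ) => D).real
        (nonNets D (eteErrorSets F f T) ε (m ε δ)) ≤ δ) :
    E2ELearnsWith F T A m :=
  fun D _ f hf ε δ hε hε1 hδ hδ1 => one_sub_le_measureReal_of_compl_subset
    (hm D f hf ε δ hε hε1 hδ hδ1) fun _ hx => hA.popError_le hf hx

theorem IsCoTConsRule.coTLearnsWith {A : CoTRule} (hA : IsCoTConsRule F T A) {m : ℝ → ℝ → ℕ}
    (hm : ∀ (D : Measure Str) [IsProbabilityMeasure D], ∀ f ∈ F, ∀ ε δ : ℝ,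
      0 < ε → ε < 1 → 0 < δ → δ < 1 → (Measure.pi fun _ : Fin (m ε δ) => D).real
        (nonNets D (cotErrorSets F f T) ε (m ε δ)) ≤ δ) :
    CoTLearnsWith F T A m :=
  fun D _ f hf ε δ hε hε1 hδ hδ1 => one_sub_le_measureReal_of_compl_subset
    (hm D f hf ε δ hε hε1 hδ hδ1) fun _ hx => hA.popError_le hf hx

variable {d N : ℕ} {L ε δ : ℝ}

/-- The number of samples drawn to learn `linClass d`, with `L` standing for the factor `T` (from
final answers) or `log (2T)` (from Chains-of-Thought) of the growth bound. -/
noncomputable def linSampleSize (d : ℕ) (L ε δ : ℝ) : ℕ :=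
  ⌈240 * ((min ((d : ℝ) ^ 2) (d * L * Real.log (2 / ε)) + Real.log (1 / δ)) / ε)⌉₊

theorem linSampleSize_le (hd : 1 ≤ d) (hL : Real.log 2 ≤ L) (hε : 0 < ε) (hε1 : ε < 1)
    (hδ : 0 < δ) (hδ1 : δ < 1) :
    (linSampleSize d L ε δ : ℝ) ≤
      480 * ((min ((d : ℝ) ^ 2) (d * L * Real.log (2 / ε)) + Real.log (1 / δ)) / ε) := by
  have hd' : (1 : ℝ) ≤ d := by exact_mod_cast hd
  have hb := log_two_le_log_two_div hε hε1
  have hlog2 := Real.log_two_gt_d9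
  have hLb : 0.48 ≤ L * Real.log (2 / ε) := by nlinarith
  have hmin : 0.48 ≤ min ((d : ℝ) ^ 2) (d * L * Real.log (2 / ε)) :=
    le_min (by nlinarith) (by nlinarith)
  have hy : 0.48 ≤ (min ((d : ℝ) ^ 2) (d * L * Real.log (2 / ε)) + Real.log (1 / δ)) / ε :=
    (le_div_iff₀ hε).2 (by linarith [log_one_div_nonneg hδ hδ1])
  have hceil := (Nat.ceil_lt_add_one (a := 240 *
    ((min ((d : ℝ) ^ 2) (d * L * Real.log (2 / ε)) + Real.log (1 / δ)) / ε)) (by linarith)).le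
  rw [linSampleSize]
  linarith

theorem le_mul_linSampleSize (hε : 0 < ε) :
    240 * (min ((d : ℝ) ^ 2) (d * L * Real.log (2 / ε)) + Real.log (1 / δ)) ≤
      ε * linSampleSize d L ε δ := by
  rw [← div_le_iff₀' hε, mul_div_assoc]
  exact Nat.le_ceil _

theorem measureReal_nonNets_linSampleSize_le (D : Measure Str) [IsProbabilityMeasure D]
    {s : Generator → Set Str} (hd : 1 ≤ d) (hN : 1 ≤ N) (hNL : Real.log (2 * N) ≤ 2 * L)
    (hgrowth : ∀ n, growthFunction (s '' linClass d) n ≤ ∑ k ∈ Iic (d + 1), (n * N).choose k)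
    (hε : 0 < ε) (hε1 : ε < 1) (hδ : 0 < δ) (hδ1 : δ < 1) :
    (Measure.pi fun _ : Fin (linSampleSize d L ε δ) => D).real
      (nonNets D (s '' linClass d) ε (linSampleSize d L ε δ)) ≤ δ := by
  refine measureReal_nonNets_le D ((finite_linClass d).image s) (fun _ _ => trivial) hgrowth
    d.succ_pos hN hε hε1 hδ hδ1 (le_trans ?_ (le_mul_linSampleSize hε))
  have hd' : (1 : ℝ) ≤ d := by exact_mod_cast hd
  have hb : 0 ≤ Real.log (2 / ε) :=
    (Real.log_nonneg one_le_two).trans (log_two_le_log_two_div hε hε1)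
  have hlogN : 0 ≤ Real.log (2 * N) :=
    (Real.log_nonneg one_le_two).trans (log_two_le_log_two_mul hN)
  have hL : 0 ≤ L := by linarith
  have hdim : (d + 1 : ℕ) * Real.log (2 * N) * Real.log (2 / ε) ≤
      6 * (d * L * Real.log (2 / ε)) := by
    have hnonneg : 0 ≤ d * L * Real.log (2 / ε) := by positivity
    calc (d + 1 : ℕ) * Real.log (2 * N) * Real.log (2 / ε)
        ≤ 2 * d * (2 * L) * Real.log (2 / ε) := by
          gcongr
          push_cast
          linarith
      _ ≤ 6 * (d * L * Real.log (2 / ε)) := by linarith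
  have hmin := min_le_min (log_ncard_image_linClass_le s hd) hdim
  rw [← mul_min_of_nonneg _ _ (by norm_num : (0 : ℝ) ≤ 6)] at hmin
  linarith [log_one_div_nonneg hδ hδ1]

theorem e2eLearnsWith_linClass (hd : 1 ≤ d) (hT : 1 ≤ T) {A : E2ERule}
    (hA : IsE2EConsRule (linClass d) T A) :
    E2ELearnsWith (linClass d) T A (linSampleSize d T) := by
  have hlog : Real.log (2 * (2 ^ T : ℕ)) ≤ 2 * T := by
    have hT' : (1 : ℝ) ≤ T := by exact_mod_cast hT
    push_cast
    rw [← pow_succ', Real.log_pow]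
    push_cast
    nlinarith [Real.log_two_lt_d9]
  exact hA.e2eLearnsWith fun D _ f _ _ _ => measureReal_nonNets_linSampleSize_le D hd
    Nat.one_le_two_pow hlog (growthFunction_eteErrorSets_le (vcDimLE_linClass d) f T)

theorem coTLearnsWith_linClass (hd : 1 ≤ d) (hT : 1 ≤ T) {A : CoTRule}
    (hA : IsCoTConsRule (linClass d) T A) :
    CoTLearnsWith (linClass d) T A (linSampleSize d (Real.log (2 * T))) := by
  have hlog : 0 ≤ Real.log (2 * T) :=
    (Real.log_nonneg one_le_two).trans (log_two_le_log_two_mul hT)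
  exact hA.coTLearnsWith fun D _ f _ _ _ => measureReal_nonNets_linSampleSize_le D hd hT
    (by linarith) (growthFunction_cotErrorSets_le (vcDimLE_linClass d) f T)

end Learning

theorem mainTheorem12 :
    (∀ d : ℕ, 1 ≤ d →
      ((restrictToLength (linClass d) d).ncard : ℝ) ≤ (2 * Real.exp 1 * 2 ^ d) ^ (d + 1)) ∧
    (∃ C : ℕ, ∀ d : ℕ, 1 ≤ d →
      (restrictToLength (linClass d) d).ncard ≤ 2 ^ (C * d ^ 2)) ∧
    (∃ C : ℝ, 0 < C ∧ ∀ d T : ℕ, 1 ≤ d → 1 ≤ T → ∃ m : ℝ → ℝ → ℕ,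
      (∀ ε δ : ℝ, 0 < ε → ε < 1 → 0 < δ → δ < 1 →
        (m ε δ : ℝ) ≤
          C * ((min ((d : ℝ) ^ 2) (d * T * Real.log (2 / ε)) + Real.log (1 / δ)) / ε)) ∧
      E2ELearnable (linClass d) T m ∧
      ∀ A : E2ERule, IsE2EConsRule (linClass d) T A → E2ELearnsWith (linClass d) T A m) ∧
    (∃ C : ℝ, 0 < C ∧ ∀ d T : ℕ, 1 ≤ d → 1 ≤ T → ∃ m : ℝ → ℝ → ℕ,
      (∀ ε δ : ℝ, 0 < ε → ε < 1 → 0 < δ → δ < 1 →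
        (m ε δ : ℝ) ≤
          C * ((min ((d : ℝ) ^ 2) (d * Real.log (2 * T) * Real.log (2 / ε)) +
            Real.log (1 / δ)) / ε)) ∧
      CoTLearnable (linClass d) T m ∧
      ∀ A : CoTRule, IsCoTConsRule (linClass d) T A → CoTLearnsWith (linClass d) T A m) := by
  refine ⟨fun d _ => ncard_restrictToLength_linClass_le d,
    ⟨8, fun d hd => ncard_restrictToLength_linClass_le_two_pow hd⟩,
    ⟨480, by norm_num, fun d T hd hT => ⟨linSampleSize d T, fun ε δ => ?_, ?_,
      fun A hA => e2eLearnsWith_linClass hd hT hA⟩⟩,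
    ⟨480, by norm_num, fun d T hd hT => ⟨linSampleSize d (Real.log (2 * T)),
      fun ε δ => linSampleSize_le hd (log_two_le_log_two_mul hT), ?_,
      fun A hA => coTLearnsWith_linClass hd hT hA⟩⟩⟩
  · have hlog : Real.log 2 ≤ T := by
      linarith [Real.log_two_lt_d9, (Nat.one_le_cast (α := ℝ)).2 hT]
    exact linSampleSize_le hd hlog
  · obtain ⟨A, hA⟩ := exists_isE2EConsRule (linClass d) T
    exact ⟨A, e2eLearnsWith_linClass hd hT hA⟩
  · obtain ⟨A, hA⟩ := exists_isCoTConsRule (linClass d) T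
    exact ⟨A, coTLearnsWith_linClass hd hT hA⟩
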